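/- Let $r, p, n, e, m$ be positive integers with $p \mid r$ and $e \mid p$. Let $G(r,p,n) \subset GL_n(\mathbb{C})$ be the group of all $n \times n$ monomial matrices (exactly one non-zero entry in each row and column) whose non-zero entries are complex $r$-th roots of unity such that the product of the non-zero entries is an $\frac{r}{p}$-th root of unity. Let $\xi_{er/p}$ be a primitive $\frac{er}{p}$-th root of unity in $\mathbb{C}$, let $\gamma = \mathrm{diag}(\xi_{er/p}, 1, \ldots, 1) \in GL_n(\mathbb{C})$, and let $\gamma G(r,p,n) = \{\gamma g \mid g \in G(r,p,n)\}$. Let $\zeta \in \mathbb{C}$ be a primitive $m$-th root of unity, and for $x \in GL_n(\mathbb{C})$ write $V(x,\zeta) = \{v \in \mathbb{C}^n \mid xv = \zeta v\}$. Then for all $x, y \in \gamma G(r,p,n)$ there exists $z \in \gamma G(r,p,n)$ such that $V(x,\zeta) \cap V(y,\zeta) = V(z,\zeta)$. -/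

import Mathlib

open scoped Pointwise

noncomputable section

/-- The monomial linear transformation `(θ ; σ)` of `ℂ^n`, sending the basis vector `e_j` to
`θ_{σ(j)} e_{σ(j)}`; it is invertible because the entries `θ_i` are units. -/
def monomialGL {n : ℕ} (θ : Fin n → ℂˣ) (σ : Equiv.Perm (Fin n)) : GL (Fin n) ℂ where
  val := Matrix.of fun i j => if i = σ j then (θ i : ℂ) else 0
  inv := Matrix.of fun i j => if σ i = j then (((θ j)⁻¹ : ℂˣ) : ℂ) else 0
  val_inv := by
    ext i j
    rw [Matrix.mul_apply, Finset.sum_eq_single (σ.symm i)]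
    · by_cases h : i = j <;> simp [h, Matrix.one_apply]
    · intro b _ hb
      have : i ≠ σ b := fun h => hb (by simp [h])
      simp [this]
    · simp
  inv_val := by
    ext i j
    rw [Matrix.mul_apply, Finset.sum_eq_single (σ i)]
    · by_cases h : i = j <;> simp [h, Matrix.one_apply]
    · intro b _ hb
      simp [Ne.symm hb]
    · simp

theorem monomialGL_mul {n : ℕ} (θ θ' : Fin n → ℂˣ) (σ σ' : Equiv.Perm (Fin n)) :
    monomialGL θ σ * monomialGL θ' σ' =
      monomialGL (fun i => θ i * θ' (σ.symm i)) (σ * σ') := by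
  apply Units.ext
  ext i j
  change ((monomialGL θ σ).val * (monomialGL θ' σ').val) i j = _
  rw [Matrix.mul_apply, Finset.sum_eq_single (σ.symm i)]
  · by_cases h : i = σ (σ' j) <;> simp [monomialGL, Equiv.symm_apply_eq, h]
  · intro b _ hb
    have : i ≠ σ b := fun h => hb (by simp [h])
    simp [monomialGL, this]
  · simp

theorem monomialGL_one {n : ℕ} :
    monomialGL (fun _ : Fin n => (1 : ℂˣ)) 1 = 1 := by
  apply Units.ext
  ext i j
  by_cases h : i = j <;> simp [monomialGL, h]

/-- The group `G(r,p,n)`: the invertible `n × n` monomial matrices whose non-zero entries `θ_i`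
are complex `r`-th roots of unity with `(θ_1 ⋯ θ_n)^(r/p) = 1`. -/
def imprimitiveGroup (r p n : ℕ) : Subgroup (GL (Fin n) ℂ) where
  carrier := {g | ∃ (θ : Fin n → ℂˣ) (σ : Equiv.Perm (Fin n)),
    (∀ i, θ i ^ r = 1) ∧ (∏ i, θ i) ^ (r / p) = 1 ∧ g = monomialGL θ σ}
  one_mem' := ⟨fun _ => 1, 1, by simp, by simp, monomialGL_one.symm⟩
  mul_mem' := by
    rintro _ _ ⟨θ, σ, h1, h2, rfl⟩ ⟨θ', σ', h1', h2', rfl⟩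
    refine ⟨_, _, ?_, ?_, monomialGL_mul θ θ' σ σ'⟩
    · intro i
      simp [mul_pow, h1, h1']
    · rw [Finset.prod_mul_distrib, Equiv.prod_comp σ.symm θ', mul_pow, h2, h2', one_mul]
  inv_mem' := by
    rintro _ ⟨θ, σ, h1, h2, rfl⟩
    refine ⟨fun i => (θ (σ i))⁻¹, σ⁻¹, ?_, ?_, ?_⟩
    · intro i
      simp [h1]
    · rw [Finset.prod_inv_distrib, Equiv.prod_comp σ θ, inv_pow, h2, inv_one]
    · rw [inv_eq_iff_mul_eq_one, monomialGL_mul]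
      simpa using monomialGL_one

/-- The diagonal transformation `diag(ξ, 1, …, 1)` of `ℂ^n`, for `n ≥ 1`. -/
def diagFirst (n : ℕ) [NeZero n] (ξ : ℂˣ) : GL (Fin n) ℂ where
  val := Matrix.diagonal fun i => if i = 0 then (ξ : ℂ) else 1
  inv := Matrix.diagonal fun i => if i = 0 then ((ξ⁻¹ : ℂˣ) : ℂ) else 1
  val_inv := by
    rw [Matrix.diagonal_mul_diagonal, ← Matrix.diagonal_one]
    congr 1
    funext i
    by_cases h : i = 0 <;> simp [h]
  inv_val := by
    rw [Matrix.diagonal_mul_diagonal, ← Matrix.diagonal_one]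
    congr 1
    funext i
    by_cases h : i = 0 <;> simp [h]

/-- The eigenspace `V(x, ζ) = {v ∈ V | x v = ζ v}` in `V = ℂ^n`. -/
def eigenV {n : ℕ} (x : GL (Fin n) ℂ) (ζ : ℂ) : Submodule ℂ (Fin n → ℂ) :=
  Module.End.eigenspace (Matrix.toLin' (x : Matrix (Fin n) (Fin n) ℂ)) ζ

end

/-!
Let `z` run over the elements of the coset `γ G` whose `ζ`-eigenspace contains a given subspace `W`,
and choose one with minimal eigenspace. If `s ∈ G` is a unitary reflection fixing `W` pointwise but
not fixing `V(z, ζ)` pointwise, then `V(z s, ζ)` is the proper subspace of `V(z, ζ)` fixed by `s`,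
and it still contains `W`; so minimality makes all such reflections fix `V(z, ζ)`. When the elements
of `G` fixing `W` are controlled by the reflections fixing `W` (Steinberg), all of them fix
`V(z, ζ)`. For any other `y ∈ γ G` with `W ≤ V(y, ζ)`, the element `z⁻¹ y` fixes `W`, hence also
`V(z, ζ)`, which means `V(z, ζ) ≤ V(y, ζ)`. Thus `V(z, ζ)` is the least eigenspace containing `W`;
for `W = V(x, ζ) ⊓ V(y, ζ)` it is equal to `W`.

For `G(r,p,n)` Steinberg's property is a computation with coordinates: the reflections fixing `W`
cut out the equations `v i = t * v j` and `v i = 0` that hold on `W`. The constraint on the product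
of the entries is met because a vector of `W` with as many non-zero coordinates as possible forces
the product of the entries at these coordinates to be `1`.
-/

open Matrix
open scoped ComplexOrder

section Coset

variable {Γ : Type*} [Group Γ] {H : Subgroup Γ} {a x y : Γ}

theorem mul_mem_leftCoset (hx : x ∈ a • (H : Set Γ)) (hy : y ∈ H) : x * y ∈ a • (H : Set Γ) := by
  rw [mem_leftCoset_iff] at hx ⊢
  rw [← mul_assoc]
  exact mul_mem hx hy

theorem inv_mul_mem_of_mem_leftCoset (hx : x ∈ a • (H : Set Γ)) (hy : y ∈ a • (H : Set Γ)) :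
    x⁻¹ * y ∈ H := by
  rw [mem_leftCoset_iff] at hx hy
  simpa [mul_assoc] using mul_mem (inv_mem hx) hy

end Coset

section Unitary

variable {ι R : Type*} [Fintype ι] [DecidableEq ι] [CommRing R]

theorem one_add_vecMulVec_mulVec_eq_self_iff [NoZeroDivisors R] {a b v : ι → R} :
    (1 + vecMulVec a b) *ᵥ v = v ↔ b ⬝ᵥ v = 0 ∨ a = 0 := by
  simp [add_mulVec, vecMulVec_mulVec]

variable [StarRing R]

theorem star_mulVec_dotProduct_mulVec_of_mem_unitaryGroup {A : Matrix ι ι R}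
    (hA : A ∈ unitaryGroup ι R) (u v : ι → R) : star (A *ᵥ u) ⬝ᵥ (A *ᵥ v) = star u ⬝ᵥ v := by
  rw [star_mulVec, dotProduct_mulVec, vecMul_vecMul, ← star_eq_conjTranspose,
    mem_unitaryGroup_iff'.mp hA, vecMul_one]

variable [PartialOrder R] [StarOrderedRing R] [NoZeroDivisors R]

theorem mul_star_self_eq_one_of_mulVec_eq_smul {A : Matrix ι ι R} (hA : A ∈ unitaryGroup ι R)
    {c : R} {v : ι → R} (hv : v ≠ 0) (hAv : A *ᵥ v = c • v) : c * star c = 1 := by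
  have hform := star_mulVec_dotProduct_mulVec_of_mem_unitaryGroup hA v v
  simp only [hAv, star_smul, smul_dotProduct, dotProduct_smul, smul_eq_mul, ← mul_assoc] at hform
  exact (mul_eq_right₀ (dotProduct_star_self_eq_zero.not.mpr hv)).mp hform

theorem mulVec_eq_self_of_star_dotProduct_mulVec_sub_eq_zero {A : Matrix ι ι R}
    (hA : A ∈ unitaryGroup ι R) {v : ι → R} (h : star v ⬝ᵥ (A *ᵥ v - v) = 0) : A *ᵥ v = v := by
  have hvA : star v ⬝ᵥ (A *ᵥ v) = star v ⬝ᵥ v := by rwa [dotProduct_sub, sub_eq_zero] at h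
  have hAv : star (A *ᵥ v) ⬝ᵥ v = star v ⬝ᵥ v := by
    rw [star_dotProduct, hvA, ← star_dotProduct]
  rw [← sub_eq_zero, ← dotProduct_star_self_eq_zero, star_sub, sub_dotProduct, h, sub_zero,
    dotProduct_sub, star_mulVec_dotProduct_mulVec_of_mem_unitaryGroup hA, hAv, sub_self]

theorem mulVec_eq_self_of_mul_one_add_vecMulVec_mulVec {A : Matrix ι ι R} {a b : ι → R}
    (hA : A ∈ unitaryGroup ι R) (hs : 1 + vecMulVec a b ∈ unitaryGroup ι R) {c : R} {u v : ι → R}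
    (hv : A *ᵥ v = c • v) (hsv : (1 + vecMulVec a b) *ᵥ v ≠ v)
    (hu : A *ᵥ ((1 + vecMulVec a b) *ᵥ u) = c • u) : (1 + vecMulVec a b) *ᵥ u = u := by
  set s := 1 + vecMulVec a b
  have hsub (w : ι → R) : s *ᵥ w - w = (b ⬝ᵥ w) • a := by
    simp [s, add_mulVec, vecMulVec_mulVec]
  have hv0 : v ≠ 0 := by rintro rfl; simp at hsv
  have hc := mul_star_self_eq_one_of_mulVec_eq_smul hA hv0 hv
  -- `A` maps the pair `v, s u` to `c v, c u`, so `⟪v, s u⟫ = ⟪v, u⟫`.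
  have horth : star v ⬝ᵥ (s *ᵥ u - u) = 0 := by
    have hform := star_mulVec_dotProduct_mulVec_of_mem_unitaryGroup hA v (s *ᵥ u)
    rw [hv, hu, star_smul, smul_dotProduct, dotProduct_smul, smul_smul, mul_comm, hc,
      one_smul] at hform
    rw [dotProduct_sub, ← hform, sub_self]
  have hva : star v ⬝ᵥ a ≠ 0 := fun h ↦ hsv <|
    mulVec_eq_self_of_star_dotProduct_mulVec_sub_eq_zero hs <| by
      rw [hsub, dotProduct_smul, h, smul_zero]
  rw [hsub, dotProduct_smul] at horth
  exact one_add_vecMulVec_mulVec_eq_self_iff.mpr (.inl ((smul_eq_zero.mp horth).resolve_right hva))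

end Unitary

section Eigenspace

variable {n : ℕ}

theorem mem_eigenV {x : GL (Fin n) ℂ} {ζ : ℂ} {v : Fin n → ℂ} :
    v ∈ eigenV x ζ ↔ x.val *ᵥ v = ζ • v := by
  simp [eigenV]

theorem eigenV_inf_eigenV_one_le_eigenV_mul (z g : GL (Fin n) ℂ) (ζ : ℂ) :
    eigenV z ζ ⊓ eigenV g 1 ≤ eigenV (z * g) ζ := by
  rintro v ⟨hz, hg⟩
  rw [SetLike.mem_coe, mem_eigenV] at hz hg
  rw [mem_eigenV, Units.val_mul, ← mulVec_mulVec, hg, one_smul, hz]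

theorem eigenV_inf_eigenV_le_eigenV_inv_mul (z x : GL (Fin n) ℂ) (ζ : ℂ) :
    eigenV z ζ ⊓ eigenV x ζ ≤ eigenV (z⁻¹ * x) 1 := by
  rintro v ⟨hz, hx⟩
  rw [SetLike.mem_coe, mem_eigenV] at hz hx
  rw [mem_eigenV, Units.val_mul, ← mulVec_mulVec, hx, ← hz, mulVec_mulVec, ← Units.val_mul,
    inv_mul_cancel, Units.val_one, one_mulVec, one_smul]

/-- A (complex) reflection: an invertible matrix differing from the identity by a matrix of rank
at most one. The identity itself is allowed. -/
def IsReflection (s : GL (Fin n) ℂ) : Prop :=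
  ∃ a b : Fin n → ℂ, s.val = 1 + vecMulVec a b

theorem IsReflection.eigenV_mul_eq {z s : GL (Fin n) ℂ} (hs : IsReflection s)
    (hzU : z.val ∈ unitaryGroup (Fin n) ℂ) (hsU : s.val ∈ unitaryGroup (Fin n) ℂ) {ζ : ℂ}
    (hzs : ¬ eigenV z ζ ≤ eigenV s 1) : eigenV (z * s) ζ = eigenV z ζ ⊓ eigenV s 1 := by
  refine le_antisymm (fun u hu ↦ ?_) (eigenV_inf_eigenV_one_le_eigenV_mul z s ζ)
  obtain ⟨v, hzv, hsv⟩ := SetLike.not_le_iff_exists.mp hzs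
  obtain ⟨a, b, hab⟩ := hs
  rw [mem_eigenV] at hzv hsv hu
  rw [Units.val_mul, ← mulVec_mulVec] at hu
  rw [one_smul] at hsv
  have hsu : s.val *ᵥ u = u := by
    rw [hab] at hsU hsv hu ⊢
    exact mulVec_eq_self_of_mul_one_add_vecMulVec_mulVec hzU hsU hzv hsv hu
  exact ⟨mem_eigenV.mpr (by rwa [hsu] at hu), mem_eigenV.mpr (by rw [hsu, one_smul])⟩

/-- The space of vectors fixed by every reflection of `G` that fixes the subspace `W` pointwise.
The fixed space of `g` is encoded as `eigenV g 1`. -/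
def reflectionHull (G : Subgroup (GL (Fin n) ℂ)) (W : Submodule ℂ (Fin n → ℂ)) :
    Submodule ℂ (Fin n → ℂ) :=
  ⨅ s ∈ {s ∈ G | IsReflection s ∧ W ≤ eigenV s 1}, eigenV s 1

theorem reflectionHull_le_eigenV_one {G : Subgroup (GL (Fin n) ℂ)} {W : Submodule ℂ (Fin n → ℂ)}
    {s : GL (Fin n) ℂ} (hsG : s ∈ G) (hs : IsReflection s) (hWs : W ≤ eigenV s 1) :
    reflectionHull G W ≤ eigenV s 1 :=
  iInf₂_le s ⟨hsG, hs, hWs⟩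

/-- The consequence of Steinberg's theorem needed for intersecting eigenspaces: the elements of `G`
fixing a subspace `W` pointwise fix all the vectors which the reflections among them fix. Steinberg
proves that these reflections generate the pointwise stabilizer of `W` when `G` is a finite complex
reflection group. -/
def HasSteinbergProperty (G : Subgroup (GL (Fin n) ℂ)) : Prop :=
  ∀ W : Submodule ℂ (Fin n → ℂ), ∀ g ∈ G, W ≤ eigenV g 1 → reflectionHull G W ≤ eigenV g 1

variable {G : Subgroup (GL (Fin n) ℂ)} {γ : GL (Fin n) ℂ}

theorem HasSteinbergProperty.exists_isLeast_eigenV (hGS : HasSteinbergProperty G)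
    (hG : ∀ g ∈ G, g.val ∈ unitaryGroup (Fin n) ℂ)
    (hγ : γ.val ∈ unitaryGroup (Fin n) ℂ) {ζ : ℂ}
    {W : Submodule ℂ (Fin n → ℂ)} {x : GL (Fin n) ℂ} (hx : x ∈ γ • (G : Set (GL (Fin n) ℂ)))
    (hWx : W ≤ eigenV x ζ) :
    ∃ E, IsLeast {E | W ≤ E ∧ ∃ z ∈ γ • (G : Set (GL (Fin n) ℂ)), eigenV z ζ = E} E := by
  obtain ⟨_, ⟨hWz, z, hz, rfl⟩, hmin⟩ := wellFounded_lt.has_min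
    {E | W ≤ E ∧ ∃ z ∈ γ • (G : Set (GL (Fin n) ℂ)), eigenV z ζ = E} ⟨_, hWx, x, hx, rfl⟩
  have hzU : z.val ∈ unitaryGroup (Fin n) ℂ := by
    obtain ⟨g, hg, rfl⟩ := hz
    exact mul_mem hγ (hG g hg)
  have hhull : eigenV z ζ ≤ reflectionHull G W := by
    refine le_iInf₂ fun s ⟨hsG, hs, hWs⟩ ↦ ?_
    by_contra hzs
    have hzs_eq := hs.eigenV_mul_eq hzU (hG s hsG) hzs
    have hW : W ≤ eigenV (z * s) ζ :=
      (le_inf hWz hWs).trans (eigenV_inf_eigenV_one_le_eigenV_mul z s ζ)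
    exact hmin _ ⟨hW, z * s, mul_mem_leftCoset hz hsG, rfl⟩
      (hzs_eq.trans_lt (inf_lt_left.mpr hzs))
  refine ⟨eigenV z ζ, ⟨hWz, z, hz, rfl⟩, ?_⟩
  rintro _ ⟨hWy, y, hy, rfl⟩
  have hW : W ≤ eigenV (z⁻¹ * y) 1 :=
    (le_inf hWz hWy).trans (eigenV_inf_eigenV_le_eigenV_inv_mul z y ζ)
  have hfixed : eigenV z ζ ≤ eigenV (z⁻¹ * y) 1 :=
    hhull.trans (hGS W _ (inv_mul_mem_of_mem_leftCoset hz hy) hW)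
  calc
    eigenV z ζ ≤ eigenV z ζ ⊓ eigenV (z⁻¹ * y) 1 := le_inf le_rfl hfixed
    _ ≤ eigenV (z * (z⁻¹ * y)) ζ := eigenV_inf_eigenV_one_le_eigenV_mul z _ ζ
    _ = eigenV y ζ := by rw [mul_inv_cancel_left]

theorem HasSteinbergProperty.exists_eigenV_inf_eq (hGS : HasSteinbergProperty G)
    (hG : ∀ g ∈ G, g.val ∈ unitaryGroup (Fin n) ℂ)
    (hγ : γ.val ∈ unitaryGroup (Fin n) ℂ) (ζ : ℂ)
    {x y : GL (Fin n) ℂ} (hx : x ∈ γ • (G : Set (GL (Fin n) ℂ)))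
    (hy : y ∈ γ • (G : Set (GL (Fin n) ℂ))) :
    ∃ z ∈ γ • (G : Set (GL (Fin n) ℂ)), eigenV x ζ ⊓ eigenV y ζ = eigenV z ζ := by
  obtain ⟨_, ⟨hle, z, hz, rfl⟩, hleast⟩ := hGS.exists_isLeast_eigenV hG hγ hx
    (inf_le_left : eigenV x ζ ⊓ eigenV y ζ ≤ eigenV x ζ)
  exact ⟨z, hz, hle.antisymm (le_inf (hleast ⟨inf_le_left, x, hx, rfl⟩)
    (hleast ⟨inf_le_right, y, hy, rfl⟩))⟩

end Eigenspace

theorem exists_mem_forall_apply_ne_zero {ι K : Type*} [Field K] [Infinite K]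
    {W : Submodule K (ι → K)} {S : Finset ι} (hS : ∀ j ∈ S, ∃ w ∈ W, w j ≠ 0) :
    ∃ w ∈ W, ∀ j ∈ S, w j ≠ 0 := by
  obtain ⟨w, hw, hwS⟩ := Module.Dual.exists_forall_mem_ne_zero_of_forall_exists W
    (fun j : S ↦ LinearMap.proj (R := K) (φ := fun _ ↦ K) j.1) fun j ↦ hS j.1 j.2
  exact ⟨w, hw, fun j hj ↦ hwS ⟨j, hj⟩⟩

section Monomial

variable {n : ℕ}

theorem monomialGL_mulVec_apply (θ : Fin n → ℂˣ) (σ : Equiv.Perm (Fin n)) (v : Fin n → ℂ)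
    (i : Fin n) :
    ((monomialGL θ σ).val *ᵥ v) i = θ i * v (σ.symm i) := by
  simp [monomialGL, mulVec, dotProduct, ← Equiv.symm_apply_eq]

theorem mem_eigenV_monomialGL {θ : Fin n → ℂˣ} {σ : Equiv.Perm (Fin n)} {ζ : ℂ}
    {v : Fin n → ℂ} :
    v ∈ eigenV (monomialGL θ σ) ζ ↔ ∀ i, θ i * v (σ.symm i) = ζ * v i := by
  simp [mem_eigenV, funext_iff, monomialGL_mulVec_apply]

theorem monomialGL_mem_unitaryGroup {θ : Fin n → ℂˣ} (hθ : ∀ i, ‖(θ i : ℂ)‖ = 1)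
    (σ : Equiv.Perm (Fin n)) :
    (monomialGL θ σ).val ∈ unitaryGroup (Fin n) ℂ := by
  have hstar : star (monomialGL θ σ).val = (monomialGL θ σ).inv := by
    ext i j
    by_cases h : σ i = j
    · simp [monomialGL, star_apply, h, Complex.inv_eq_conj (hθ j)]
    · simp [monomialGL, star_apply, h, Ne.symm h]
  rw [mem_unitaryGroup_iff, hstar]
  exact (monomialGL θ σ).val_inv

theorem prod_eq_pow_card_of_mem_eigenV_monomialGL {θ : Fin n → ℂˣ} {σ : Equiv.Perm (Fin n)}
    {ζ : ℂ} {w : Fin n → ℂ} (hw : w ∈ eigenV (monomialGL θ σ) ζ) {S : Finset (Fin n)}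
    (hσS : ∀ j, σ.symm j ∈ S ↔ j ∈ S) (hwS : ∀ j ∈ S, w j ≠ 0) :
    ∏ j ∈ S, (θ j : ℂ) = ζ ^ S.card := by
  have hperm : ∏ j ∈ S, w (σ.symm j) = ∏ j ∈ S, w j :=
    Finset.prod_equiv σ.symm (fun j ↦ (hσS j).symm) fun _ _ ↦ rfl
  apply mul_right_cancel₀ (Finset.prod_ne_zero_iff.mpr hwS)
  calc
    (∏ j ∈ S, (θ j : ℂ)) * ∏ j ∈ S, w j = ∏ j ∈ S, (θ j * w (σ.symm j)) := by
      rw [Finset.prod_mul_distrib, hperm]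
    _ = ∏ j ∈ S, (ζ * w j) := Finset.prod_congr rfl fun j _ ↦ mem_eigenV_monomialGL.mp hw j
    _ = ζ ^ S.card * ∏ j ∈ S, w j := by rw [Finset.prod_mul_distrib, Finset.prod_const]

theorem prod_eq_apply_of_le_eigenV_monomialGL_one {W : Submodule ℂ (Fin n → ℂ)} {θ : Fin n → ℂˣ}
    {σ : Equiv.Perm (Fin n)} (hW : W ≤ eigenV (monomialGL θ σ) 1) {i : Fin n}
    (hσi : σ.symm i = i) (hWne : ∀ j ≠ i, ∃ w ∈ W, w j ≠ 0) : ∏ j, θ j = θ i := by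
  obtain ⟨w, hw, hwne⟩ := exists_mem_forall_apply_ne_zero (S := Finset.univ.erase i)
    fun j hj ↦ hWne j (Finset.ne_of_mem_erase hj)
  have hσ (j : Fin n) : σ.symm j ∈ Finset.univ.erase i ↔ j ∈ Finset.univ.erase i := by
    simp only [Finset.mem_erase, Finset.mem_univ, and_true]
    rw [← σ.symm.injective.ne_iff (x := j), hσi]
  have hprod := prod_eq_pow_card_of_mem_eigenV_monomialGL (hW hw) hσ hwne
  rw [one_pow, ← Units.coe_prod, Units.val_eq_one] at hprod
  rw [← Finset.mul_prod_erase _ _ (Finset.mem_univ i), hprod, mul_one]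

theorem apply_eq_zero_of_mem_eigenV_monomialGL_one {θ : Fin n → ℂˣ} {σ : Equiv.Perm (Fin n)}
    {i : Fin n} (hσi : σ.symm i = i) (hθi : θ i ≠ 1) {w : Fin n → ℂ}
    (hw : w ∈ eigenV (monomialGL θ σ) 1) : w i = 0 := by
  have hwi := mem_eigenV_monomialGL.mp hw i
  rw [hσi, one_mul] at hwi
  by_contra hne
  exact hθi (Units.val_eq_one.mp ((mul_eq_right₀ hne).mp hwi))

/-- The monomial reflection interchanging the coordinate lines of `e_i` and `e_j`, which sends
`e_j` to `t e_i` and `e_i` to `t⁻¹ e_j`. -/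
def scaledSwap (i j : Fin n) (t : ℂˣ) : GL (Fin n) ℂ :=
  monomialGL (Pi.mulSingle i t * Pi.mulSingle j t⁻¹) (Equiv.swap i j)

/-- The diagonal reflection which multiplies the `j`-th coordinate by `t`. -/
def coordScaling (j : Fin n) (t : ℂˣ) : GL (Fin n) ℂ :=
  monomialGL (Pi.mulSingle j t) 1

theorem coe_scaledSwap {i j : Fin n} (hij : i ≠ j) (t : ℂˣ) :
    (scaledSwap i j t).val =
      1 + vecMulVec (Pi.single i 1 - Pi.single j (t : ℂ)⁻¹)
        (Pi.single j (t : ℂ) - Pi.single i 1) := by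
  ext k l
  simp only [scaledSwap, monomialGL, of_apply, Matrix.add_apply, vecMulVec_apply, Pi.sub_apply,
    Pi.mul_apply, Pi.single_apply, Pi.mulSingle_apply, Equiv.swap_apply_def, one_apply]
  split_ifs <;> simp_all

theorem coe_coordScaling (j : Fin n) (t : ℂˣ) :
    (coordScaling j t).val = 1 + vecMulVec (Pi.single j 1) (Pi.single j ((t : ℂ) - 1)) := by
  ext k l
  simp only [coordScaling, monomialGL, of_apply, Matrix.add_apply, vecMulVec_apply, Pi.single_apply,
    Pi.mulSingle_apply, Equiv.Perm.one_apply, one_apply]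
  split_ifs <;> simp_all

theorem isReflection_scaledSwap {i j : Fin n} (hij : i ≠ j) (t : ℂˣ) :
    IsReflection (scaledSwap i j t) :=
  ⟨_, _, coe_scaledSwap hij t⟩

theorem isReflection_coordScaling (j : Fin n) (t : ℂˣ) : IsReflection (coordScaling j t) :=
  ⟨_, _, coe_coordScaling j t⟩

theorem mem_eigenV_scaledSwap_one {i j : Fin n} (hij : i ≠ j) {t : ℂˣ} {v : Fin n → ℂ} :
    v ∈ eigenV (scaledSwap i j t) 1 ↔ v i = t * v j := by
  have ha : (Pi.single i 1 - Pi.single j (t : ℂ)⁻¹ : Fin n → ℂ) ≠ 0 := fun h ↦ by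
    simpa [hij] using congrFun h i
  rw [mem_eigenV, one_smul, coe_scaledSwap hij, one_add_vecMulVec_mulVec_eq_self_iff,
    or_iff_left ha, sub_dotProduct, single_dotProduct, single_one_dotProduct, sub_eq_zero, eq_comm]

theorem mem_eigenV_coordScaling_one {j : Fin n} {t : ℂˣ} (ht : t ≠ 1) {v : Fin n → ℂ} :
    v ∈ eigenV (coordScaling j t) 1 ↔ v j = 0 := by
  have ht' : (t : ℂ) - 1 ≠ 0 := sub_ne_zero.mpr (Units.val_eq_one.not.mpr ht)
  simp [mem_eigenV, coe_coordScaling, one_add_vecMulVec_mulVec_eq_self_iff, ht']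

theorem diagFirst_eq_coordScaling [NeZero n] (ξ : ℂˣ) : diagFirst n ξ = coordScaling 0 ξ := by
  ext i j
  simp only [diagFirst, coordScaling, monomialGL, diagonal_apply, of_apply, Equiv.Perm.one_apply,
    Pi.mulSingle_apply]
  split_ifs <;> simp_all

theorem coordScaling_mem_unitaryGroup (j : Fin n) {t : ℂˣ} (ht : ‖(t : ℂ)‖ = 1) :
    (coordScaling j t).val ∈ unitaryGroup (Fin n) ℂ := by
  refine monomialGL_mem_unitaryGroup (fun i ↦ ?_) 1
  rw [Pi.mulSingle_apply]
  split_ifs <;> simp [ht]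

theorem diagFirst_mem_unitaryGroup [NeZero n] {ξ : ℂˣ} (hξ : ‖(ξ : ℂ)‖ = 1) :
    (diagFirst n ξ).val ∈ unitaryGroup (Fin n) ℂ := by
  rw [diagFirst_eq_coordScaling]
  exact coordScaling_mem_unitaryGroup 0 hξ

variable {r p : ℕ}

theorem scaledSwap_mem_imprimitiveGroup (i j : Fin n) {t : ℂˣ} (ht : t ^ r = 1) :
    scaledSwap i j t ∈ imprimitiveGroup r p n := by
  refine ⟨_, _, fun k ↦ ?_, ?_, rfl⟩
  · simp only [Pi.mul_apply, Pi.mulSingle_apply, mul_pow]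
    split_ifs <;> simp [ht]
  · simp [Finset.prod_mul_distrib]

theorem coordScaling_mem_imprimitiveGroup (j : Fin n) {t : ℂˣ} (htr : t ^ r = 1)
    (htp : t ^ (r / p) = 1) : coordScaling j t ∈ imprimitiveGroup r p n := by
  refine ⟨_, _, fun k ↦ ?_, ?_, rfl⟩
  · simp only [Pi.mulSingle_apply]
    split_ifs <;> simp [htr]
  · simp [htp]

theorem coe_mem_unitaryGroup_of_mem_imprimitiveGroup (hr : r ≠ 0) {g : GL (Fin n) ℂ}
    (hg : g ∈ imprimitiveGroup r p n) :
    g.val ∈ unitaryGroup (Fin n) ℂ := by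
  obtain ⟨θ, σ, hθ, -, rfl⟩ := hg
  refine monomialGL_mem_unitaryGroup (fun i ↦ Complex.norm_eq_one_of_pow_eq_one ?_ hr) σ
  rw [← Units.val_pow_eq_pow_val, hθ i, Units.val_one]

theorem apply_eq_mul_of_mem_reflectionHull {W : Submodule ℂ (Fin n → ℂ)} {v : Fin n → ℂ}
    (hv : v ∈ reflectionHull (imprimitiveGroup r p n) W) {i j : Fin n} (hij : i ≠ j) {t : ℂˣ}
    (ht : t ^ r = 1) (hW : ∀ w ∈ W, w i = t * w j) : v i = t * v j := by
  rw [← mem_eigenV_scaledSwap_one hij]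
  exact reflectionHull_le_eigenV_one (scaledSwap_mem_imprimitiveGroup i j ht)
    (isReflection_scaledSwap hij t) (fun w hw ↦ (mem_eigenV_scaledSwap_one hij).mpr (hW w hw)) hv

theorem apply_eq_zero_of_mem_reflectionHull {W : Submodule ℂ (Fin n → ℂ)} {v : Fin n → ℂ}
    (hv : v ∈ reflectionHull (imprimitiveGroup r p n) W) {j : Fin n} {t : ℂˣ} (ht : t ≠ 1)
    (htr : t ^ r = 1) (htp : t ^ (r / p) = 1) (hW : ∀ w ∈ W, w j = 0) : v j = 0 := by
  rw [← mem_eigenV_coordScaling_one ht]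
  exact reflectionHull_le_eigenV_one (coordScaling_mem_imprimitiveGroup j htr htp)
    (isReflection_coordScaling j t) (fun w hw ↦ (mem_eigenV_coordScaling_one ht).mpr (hW w hw)) hv

theorem apply_eq_zero_of_mem_reflectionHull_of_ne {W : Submodule ℂ (Fin n → ℂ)} {v : Fin n → ℂ}
    (hv : v ∈ reflectionHull (imprimitiveGroup r p n) W) {i j : Fin n} (hij : i ≠ j) {t : ℂˣ}
    (ht : t ≠ 1) (htr : t ^ r = 1) (hWi : ∀ w ∈ W, w i = 0) (hWj : ∀ w ∈ W, w j = 0) :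
    v i = 0 := by
  have hone : v i = (1 : ℂˣ) * v j := apply_eq_mul_of_mem_reflectionHull hv hij (one_pow r)
    fun w hw ↦ by rw [hWi w hw, hWj w hw, mul_zero]
  have ht' : v i = t * v j := apply_eq_mul_of_mem_reflectionHull hv hij htr
    fun w hw ↦ by rw [hWi w hw, hWj w hw, mul_zero]
  rw [Units.val_one, one_mul] at hone
  rw [← hone] at ht'
  by_contra hvi
  exact ht (Units.val_eq_one.mp ((mul_eq_right₀ hvi).mp ht'.symm))

theorem hasSteinbergProperty_imprimitiveGroup (r p n : ℕ) :
    HasSteinbergProperty (imprimitiveGroup r p n) := by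
  rintro W _ ⟨θ, σ, hθ, hprod, rfl⟩ hW v hv
  refine mem_eigenV_monomialGL.mpr fun i ↦ ?_
  rw [one_mul]
  rcases ne_or_eq (σ.symm i) i with hσi | hσi
  · refine (apply_eq_mul_of_mem_reflectionHull hv hσi.symm (hθ i) fun w hw ↦ ?_).symm
    rw [mem_eigenV_monomialGL.mp (hW hw) i, one_mul]
  rw [hσi]
  rcases eq_or_ne (θ i) 1 with hθi | hθi
  · rw [hθi, Units.val_one, one_mul]
  have hWi : ∀ w ∈ W, w i = 0 := fun w hw ↦
    apply_eq_zero_of_mem_eigenV_monomialGL_one hσi hθi (hW hw)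
  suffices v i = 0 by rw [this, mul_zero]
  by_cases hWj : ∃ j ≠ i, ∀ w ∈ W, w j = 0
  · obtain ⟨j, hji, hWj⟩ := hWj
    exact apply_eq_zero_of_mem_reflectionHull_of_ne hv hji.symm hθi (hθ i) hWi hWj
  · push Not at hWj
    rw [prod_eq_apply_of_le_eigenV_monomialGL_one hW hσi hWj] at hprod
    exact apply_eq_zero_of_mem_reflectionHull hv hθi (hθ i) hprod hWi

end Monomial

theorem mainTheorem11_general {r p n : ℕ} (hr : r ≠ 0) {γ : GL (Fin n) ℂ}
    (hγ : γ.val ∈ unitaryGroup (Fin n) ℂ) (ζ : ℂ) {x y : GL (Fin n) ℂ}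
    (hx : x ∈ γ • (imprimitiveGroup r p n : Set (GL (Fin n) ℂ)))
    (hy : y ∈ γ • (imprimitiveGroup r p n : Set (GL (Fin n) ℂ))) :
    ∃ z ∈ γ • (imprimitiveGroup r p n : Set (GL (Fin n) ℂ)),
      eigenV x ζ ⊓ eigenV y ζ = eigenV z ζ :=
  (hasSteinbergProperty_imprimitiveGroup r p n).exists_eigenV_inf_eq
    (fun _ ↦ coe_mem_unitaryGroup_of_mem_imprimitiveGroup hr) hγ ζ hx hy

theorem mainTheorem11 (r p n e m : ℕ) [NeZero n] (hr : 0 < r) (hp : p ∣ r) (he : e ∣ p)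
    (ξ : ℂˣ) (hξ : IsPrimitiveRoot (ξ : ℂ) (e * r / p))
    (ζ : ℂ) (hm : 0 < m) (hζ : IsPrimitiveRoot ζ m)
    (x y : GL (Fin n) ℂ)
    (hx : x ∈ diagFirst n ξ • (imprimitiveGroup r p n : Set (GL (Fin n) ℂ)))
    (hy : y ∈ diagFirst n ξ • (imprimitiveGroup r p n : Set (GL (Fin n) ℂ))) :
    ∃ z ∈ diagFirst n ξ • (imprimitiveGroup r p n : Set (GL (Fin n) ℂ)),
      eigenV x ζ ⊓ eigenV y ζ = eigenV z ζ := by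
  have hp0 : p ≠ 0 := ne_zero_of_dvd_ne_zero hr.ne' hp
  have hk : e * r / p ≠ 0 := (Nat.div_ne_zero_iff_of_dvd (hp.mul_left e)).mpr
    ⟨mul_ne_zero (ne_zero_of_dvd_ne_zero hp0 he) hr.ne', hp0⟩
  exact mainTheorem11_general hr.ne' (diagFirst_mem_unitaryGroup (hξ.norm'_eq_one hk)) ζ hx hy
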